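/- Let $q$ be a prime power, let $\mathbb{F}_{q^2}$ be the field with $q^2$ elements, and equip $\mathbb{F}_{q^2}^n$ with the Hermitian inner product $\langle x,y\rangle_H=\sum_{i=1}^n x_i y_i^q$. For a linear code (linear subspace) $C\subseteq\mathbb{F}_{q^2}^n$ put $C^{\perp_H}=\{y\in\mathbb{F}_{q^2}^n : \langle x,y\rangle_H=0 \text{ for all } x\in C\}$ and $\mathrm{Hull}_H(C)=C\cap C^{\perp_H}$, and let $$A^H_{n,k,\ell,q}=\bigl|\{C\subseteq\mathbb{F}_{q^2}^n : \dim C=k,\ \dim\mathrm{Hull}_H(C)=\ell\}\bigr|.$$ Let $n,k,\ell$ be integers with $0\le\ell<\min(k,n-k)$. Then $$A^H_{n,k,\ell,q}>A^H_{n,k,\ell+1,q},$$ except when $q=2$, $\ell=0$, $n$ is even and $k\in\{1,n-1\}$. In each of these exceptional cases the reverse strict inequality $A^H_{n,k,0,2}<A^H_{n,k,1,2}$ holds. -/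

import Mathlib

/-- If the field `F` has `q ^ 2` elements, `q` a prime power, then `x ↦ x ^ q` is additive on `F`. -/
theorem add_pow_of_natCard_eq_sq {F : Type*} [Field F] {q : ℕ} (hF : Nat.card F = q ^ 2)
    (hq : IsPrimePow q) (x y : F) : (x + y) ^ q = x ^ q + y ^ q := by
  have hfin : Finite F := Nat.finite_of_card_ne_zero (by rw [hF]; exact pow_ne_zero _ hq.ne_zero)
  have := Fintype.ofFinite F
  obtain ⟨p, hp⟩ := CharP.exists F
  obtain ⟨m, hprime, hm⟩ := FiniteField.card F p
  have : Fact p.Prime := ⟨hprime⟩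
  have hdvd : q ∣ p ^ (m : ℕ) := by
    rw [← hm, ← Nat.card_eq_fintype_card, hF]
    exact dvd_pow_self q two_ne_zero
  obtain ⟨j, -, rfl⟩ := (Nat.dvd_prime_pow hprime).1 hdvd
  exact add_pow_char_pow x y p j

/-- The Hermitian inner product `⟨x, y⟩_H = ∑ i, x i * (y i) ^ q` on `F ^ n`, where `F` is the
field with `q ^ 2` elements. -/
def hermitianInner {F : Type*} [Field F] (q : ℕ) {n : ℕ} (x y : Fin n → F) : F :=
  ∑ i, x i * y i ^ q

/-- The Hermitian dual `{y | ⟨x, y⟩_H = 0 for all x ∈ C}` of a linear code `C`. -/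
def hermitianDual {F : Type*} [Field F] {q : ℕ} (hq : IsPrimePow q) (hF : Nat.card F = q ^ 2)
    {n : ℕ} (C : Submodule F (Fin n → F)) : Submodule F (Fin n → F) where
  carrier := {y | ∀ x ∈ C, hermitianInner q x y = 0}
  zero_mem' := by
    intro x _
    simp [hermitianInner, hq.ne_zero]
  add_mem' := by
    intro a b ha hb x hx
    have h1 := ha x hx
    have h2 := hb x hx
    simp only [hermitianInner] at h1 h2 ⊢
    simp only [Pi.add_apply, add_pow_of_natCard_eq_sq hF hq, mul_add, Finset.sum_add_distrib,
      h1, h2, add_zero]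
  smul_mem' := by
    intro c a ha x hx
    have h1 := ha x hx
    simp only [hermitianInner] at h1 ⊢
    calc ∑ i, x i * (c • a) i ^ q = c ^ q * ∑ i, x i * a i ^ q := by
          rw [Finset.mul_sum]
          refine Finset.sum_congr rfl fun i _ => ?_
          rw [Pi.smul_apply, smul_eq_mul, mul_pow, mul_left_comm]
      _ = 0 := by rw [h1, mul_zero]

/-- The Hermitian hull of a linear code: its intersection with its Hermitian dual. -/
def hermitianHull {F : Type*} [Field F] {q : ℕ} (hq : IsPrimePow q) (hF : Nat.card F = q ^ 2)
    {n : ℕ} (C : Submodule F (Fin n → F)) : Submodule F (Fin n → F) :=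
  C ⊓ hermitianDual hq hF C

/-- The number of `k`-dimensional linear codes in `F ^ n` whose Hermitian hull has
dimension `l`, where `F` is the field with `q ^ 2` elements. -/
noncomputable def hermitianHullCount {F : Type*} [Field F] {q : ℕ} (hq : IsPrimePow q)
    (hF : Nat.card F = q ^ 2) (n k l : ℕ) : ℕ :=
  Nat.card {C : Submodule F (Fin n → F) //
    Module.finrank F C = k ∧ Module.finrank F (hermitianHull hq hF C) = l}

/-!
Write `Q = q ^ 2`. Let `A k l` be the number of `k`-dimensional codes with a hull of dimension `l`,
and put `a = k - l`, `b = n - k - l`. The theorem follows from the ratio of consecutive counts,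

  `A k (l + 1) * q ^ (a + b - 1) * (q ^ (2 * l + 2) - 1)`
    `= A k l * (q ^ a - (-1) ^ a) * (q ^ b - (-1) ^ b)`

(`hermitianHullCount_succ_hull`, with `a` shifted by one), once `A k l` is known to be positive
(`hermitianHullCount_pos`): it remains to see which of the two factors is larger. The crude bound
`q ^ a + 1` for `q ^ a - (-1) ^ a` decides this unless `q = 2` and `l = 0`, where the parities of
`a` and `b` matter.

No classification of Hermitian spaces is needed for the ratio. If `⟨z, w⟩ ≠ 0`, then
`D ↦ D + F z` and `C ↦ C ∩ w^⊥` are inverse bijections between the codes contained in `w^⊥` and the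
codes containing `z` (`natCard_code_pairs`). Two double counts relate both `A k l` and `A k (l + 1)`
to `A (k - 1) l`:

* If `z = w` is nonisotropic, the hull does not change. Counting pairs `(C, z)` therefore compares
  the nonisotropic vectors of `C` with those of `D^⊥` (`hermitianHullCount_succ_dim`).
* If `z` is isotropic and orthogonal to `D`, the hull of `D + F z` is the hull of `D` plus `F z`.
  Counting triples `(C, z, w)` with `z` a nonzero vector of the hull of `C` compares
  `Q ^ (l + 1) - 1` with the number of isotropic vectors in `D^⊥` outside `D`
  (`hermitianHullCount_succ_succ`).

Both comparisons need only the number of nonisotropic vectors of a code whose dimension and hull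
dimension are known (`nonisotropicCount_formula`). It is found by splitting off one nonisotropic
vector at a time, because each nonzero element of the subfield with `q` elements is the norm
`c ^ (q + 1)` of exactly `q + 1` elements `c` of `F` (`natCard_norm_eq`).
-/

open Module Submodule

section

variable {F : Type*} [Field F] {q n : ℕ}

/-! ### The Hermitian form -/

theorem finite_of_natCard_eq_sq {F : Type*} {q : ℕ} (hq : IsPrimePow q)
    (hF : Nat.card F = q ^ 2) : Finite F :=
  Nat.finite_of_card_ne_zero (by rw [hF]; exact pow_ne_zero _ hq.ne_zero)

theorem pow_pow_of_natCard_eq_sq (hq : IsPrimePow q) (hF : Nat.card F = q ^ 2) (c : F) :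
    (c ^ q) ^ q = c := by
  have := finite_of_natCard_eq_sq hq hF
  have := Fintype.ofFinite F
  rw [← pow_mul, ← sq, ← hF, Nat.card_eq_fintype_card, FiniteField.pow_card]

/-- The involution `c ↦ c ^ q` of the field with `q ^ 2` elements. -/
def conjEquiv (hq : IsPrimePow q) (hF : Nat.card F = q ^ 2) : F ≃+* F where
  toFun c := c ^ q
  invFun c := c ^ q
  left_inv := pow_pow_of_natCard_eq_sq hq hF
  right_inv := pow_pow_of_natCard_eq_sq hq hF
  map_mul' x y := mul_pow x y q
  map_add' := add_pow_of_natCard_eq_sq hF hq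

theorem hermitianInner_add_left (x y z : Fin n → F) :
    hermitianInner q (x + y) z = hermitianInner q x z + hermitianInner q y z := by
  simp [hermitianInner, add_mul, Finset.sum_add_distrib]

theorem hermitianInner_smul_left (c : F) (x y : Fin n → F) :
    hermitianInner q (c • x) y = c * hermitianInner q x y := by
  simp [hermitianInner, Finset.mul_sum, mul_assoc]

theorem hermitianInner_conj (hq : IsPrimePow q) (hF : Nat.card F = q ^ 2) (x y : Fin n → F) :
    hermitianInner q x y ^ q = hermitianInner q y x := by
  change conjEquiv hq hF _ = _
  rw [hermitianInner, map_sum, hermitianInner]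
  refine Finset.sum_congr rfl fun i _ => ?_
  change (x i * y i ^ q) ^ q = _
  rw [mul_pow, pow_pow_of_natCard_eq_sq hq hF, mul_comm]

theorem hermitianInner_eq_zero_comm (hq : IsPrimePow q) (hF : Nat.card F = q ^ 2)
    {x y : Fin n → F} : hermitianInner q x y = 0 ↔ hermitianInner q y x = 0 := by
  rw [← hermitianInner_conj hq hF x y, pow_eq_zero_iff hq.ne_zero]

theorem hermitianInner_add_right (hq : IsPrimePow q) (hF : Nat.card F = q ^ 2)
    (x y z : Fin n → F) :
    hermitianInner q x (y + z) = hermitianInner q x y + hermitianInner q x z := by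
  simp only [← hermitianInner_conj hq hF _ x, hermitianInner_add_left,
    add_pow_of_natCard_eq_sq hF hq]

theorem hermitianInner_smul_right (hq : IsPrimePow q) (hF : Nat.card F = q ^ 2)
    (c : F) (x y : Fin n → F) :
    hermitianInner q x (c • y) = c ^ q * hermitianInner q x y := by
  simp only [← hermitianInner_conj hq hF _ x, hermitianInner_smul_left, mul_pow]

theorem mem_hermitianDual {hq : IsPrimePow q} {hF : Nat.card F = q ^ 2}
    {C : Submodule F (Fin n → F)} {y : Fin n → F} :
    y ∈ hermitianDual hq hF C ↔ ∀ x ∈ C, hermitianInner q x y = 0 := Iff.rfl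

theorem mem_hermitianDual_span_singleton {hq : IsPrimePow q} {hF : Nat.card F = q ^ 2}
    {x y : Fin n → F} :
    y ∈ hermitianDual hq hF (span F {x}) ↔ hermitianInner q x y = 0 := by
  rw [mem_hermitianDual]
  refine ⟨fun h => h x (mem_span_singleton_self x), fun h z hz => ?_⟩
  obtain ⟨c, rfl⟩ := mem_span_singleton.1 hz
  rw [hermitianInner_smul_left, h, mul_zero]

theorem le_hermitianDual_comm {hq : IsPrimePow q} {hF : Nat.card F = q ^ 2}
    {C D : Submodule F (Fin n → F)} :
    C ≤ hermitianDual hq hF D ↔ D ≤ hermitianDual hq hF C :=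
  ⟨fun h _ hx _ hy => (hermitianInner_eq_zero_comm hq hF).1 (h hy _ hx),
    fun h _ hx _ hy => (hermitianInner_eq_zero_comm hq hF).1 (h hy _ hx)⟩

theorem le_hermitianDual_span_singleton {hq : IsPrimePow q} {hF : Nat.card F = q ^ 2}
    {D : Submodule F (Fin n → F)} {x : Fin n → F} :
    D ≤ hermitianDual hq hF (span F {x}) ↔ x ∈ hermitianDual hq hF D := by
  rw [le_hermitianDual_comm, span_singleton_le_iff_mem]

theorem natCard_submodule (hF : Nat.card F = q ^ 2) (C : Submodule F (Fin n → F)) :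
    Nat.card C = (q ^ 2) ^ finrank F C := by
  rw [Module.natCard_eq_pow_finrank (K := F), hF]

/-- Coordinatewise conjugation carries the Hermitian dual onto the dual for the standard bilinear
form, so the two have the same number of elements. -/
theorem finrank_hermitianDual (hq : IsPrimePow q) (hF : Nat.card F = q ^ 2)
    (C : Submodule F (Fin n → F)) :
    finrank F (hermitianDual hq hF C) = n - finrank F C := by
  have := finite_of_natCard_eq_sq hq hF
  let B : LinearMap.BilinForm F (Fin n → F) := Matrix.toBilin' (1 : Matrix (Fin n) (Fin n) F)
  have hB : B.Nondegenerate := (Matrix.nondegenerate_of_det_ne_zero (by simp)).toBilin'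
  have h1 : finrank F (B.orthogonal C) = n - finrank F C := by
    rw [LinearMap.BilinForm.finrank_orthogonal hB]; simp
  rw [← h1]
  have hcard : Nat.card (hermitianDual hq hF C) = Nat.card (B.orthogonal C) := by
    refine Nat.card_congr ((Equiv.piCongrRight fun _ : Fin n =>
      (conjEquiv hq hF).toEquiv).subtypeEquiv fun y => ?_)
    change (∀ x ∈ C, hermitianInner q x y = 0) ↔ ∀ x ∈ C, B x _ = 0
    refine forall₂_congr fun x _ => ?_
    simp [B, Matrix.toBilin'_apply', hermitianInner, dotProduct, conjEquiv]
  rw [natCard_submodule hF, natCard_submodule hF] at hcard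
  exact Nat.pow_right_injective (one_lt_pow₀ hq.one_lt two_ne_zero) hcard

theorem hermitianDual_hermitianDual (hq : IsPrimePow q) (hF : Nat.card F = q ^ 2)
    (C : Submodule F (Fin n → F)) :
    hermitianDual hq hF (hermitianDual hq hF C) = C := by
  have hle : C ≤ hermitianDual hq hF (hermitianDual hq hF C) := le_hermitianDual_comm.1 le_rfl
  refine (eq_of_le_of_finrank_eq hle ?_).symm
  have := finrank_le C
  rw [finrank_hermitianDual, finrank_hermitianDual]
  simp at this
  omega

theorem hermitianHull_hermitianDual (hq : IsPrimePow q) (hF : Nat.card F = q ^ 2)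
    (C : Submodule F (Fin n → F)) :
    hermitianHull hq hF (hermitianDual hq hF C) = hermitianHull hq hF C := by
  rw [hermitianHull, hermitianDual_hermitianDual, inf_comm, hermitianHull]

theorem mem_hermitianHull {hq : IsPrimePow q} {hF : Nat.card F = q ^ 2}
    {C : Submodule F (Fin n → F)} {y : Fin n → F} :
    y ∈ hermitianHull hq hF C ↔ y ∈ C ∧ ∀ x ∈ C, hermitianInner q x y = 0 := Iff.rfl

/-! ### Adding a vector to a code -/

theorem isCompl_hermitianDual_span_singleton (hq : IsPrimePow q) (hF : Nat.card F = q ^ 2)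
    {z w : Fin n → F} (hzw : hermitianInner q z w ≠ 0) :
    IsCompl (hermitianDual hq hF (span F {w})) (span F {z}) := by
  have hwz : hermitianInner q w z ≠ 0 := fun h => hzw ((hermitianInner_eq_zero_comm hq hF).1 h)
  constructor
  · rw [disjoint_def]
    intro x hx hxz
    obtain ⟨c, rfl⟩ := mem_span_singleton.1 hxz
    rw [mem_hermitianDual_span_singleton, hermitianInner_smul_right hq hF, mul_eq_zero,
      or_iff_left hwz, pow_eq_zero_iff hq.ne_zero] at hx
    rw [hx, zero_smul]
  · rw [codisjoint_iff, eq_top_iff]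
    intro x _
    -- the form is conjugate-linear in its second argument, so `z` needs a `q`-th power here
    let c : F := (-(hermitianInner q w x / hermitianInner q w z)) ^ q
    have hx : x = (x + c • z) + (-c) • z := by module
    rw [hx]
    refine add_mem_sup ?_ (smul_mem _ _ (mem_span_singleton_self z))
    rw [mem_hermitianDual_span_singleton, hermitianInner_add_right hq hF,
      hermitianInner_smul_right hq hF, pow_pow_of_natCard_eq_sq hq hF, neg_mul,
      div_mul_cancel₀ _ hwz, add_neg_cancel]

theorem inf_hermitianDual_sup_span_singleton (hq : IsPrimePow q) (hF : Nat.card F = q ^ 2)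
    {C : Submodule F (Fin n → F)} {z w : Fin n → F} (hzw : hermitianInner q z w ≠ 0)
    (hz : z ∈ C) : C ⊓ hermitianDual hq hF (span F {w}) ⊔ span F {z} = C := by
  rw [inf_sup_assoc_of_le _ ((span_singleton_le_iff_mem _ _).2 hz),
    (isCompl_hermitianDual_span_singleton hq hF hzw).sup_eq_top, inf_top_eq]

theorem sup_span_singleton_inf_hermitianDual (hq : IsPrimePow q) (hF : Nat.card F = q ^ 2)
    {D : Submodule F (Fin n → F)} {z w : Fin n → F} (hzw : hermitianInner q z w ≠ 0)
    (hD : D ≤ hermitianDual hq hF (span F {w})) :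
    (D ⊔ span F {z}) ⊓ hermitianDual hq hF (span F {w}) = D := by
  rw [sup_inf_assoc_of_le _ hD, inf_comm,
    (isCompl_hermitianDual_span_singleton hq hF hzw).inf_eq_bot, sup_bot_eq]

theorem mem_sup_span_singleton' {D : Submodule F (Fin n → F)} {x y : Fin n → F} :
    y ∈ D ⊔ span F {x} ↔ ∃ d ∈ D, ∃ c : F, d + c • x = y := by
  simp [mem_sup, mem_span_singleton]

theorem finrank_sup_span_singleton_of_inner_ne_zero {hq : IsPrimePow q} {hF : Nat.card F = q ^ 2}
    {D : Submodule F (Fin n → F)} {z w : Fin n → F} (hzw : hermitianInner q z w ≠ 0)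
    (hD : D ≤ hermitianDual hq hF (span F {w})) :
    finrank F ↥(D ⊔ span F {z}) = finrank F D + 1 := by
  have hz : z ∉ D := fun h =>
    hzw ((hermitianInner_eq_zero_comm hq hF).1 (mem_hermitianDual_span_singleton.1 (hD h)))
  exact finrank_sup_span_singleton hz

theorem hermitianHull_sup_of_nonisotropic {hq : IsPrimePow q} {hF : Nat.card F = q ^ 2}
    {D : Submodule F (Fin n → F)} {x : Fin n → F} (hx : hermitianInner q x x ≠ 0)
    (hD : x ∈ hermitianDual hq hF D) :
    hermitianHull hq hF (D ⊔ span F {x}) = hermitianHull hq hF D := by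
  have hxD : ∀ d ∈ D, hermitianInner q x d = 0 := fun d hd =>
    (hermitianInner_eq_zero_comm hq hF).1 (hD d hd)
  ext y
  simp only [mem_hermitianHull, mem_sup_span_singleton']
  constructor
  · rintro ⟨⟨d, hd, c, rfl⟩, h⟩
    have h1 := h x ⟨0, zero_mem _, 1, by simp⟩
    rw [hermitianInner_add_right hq hF, hxD d hd, hermitianInner_smul_right hq hF, zero_add,
      mul_eq_zero, or_iff_left hx, pow_eq_zero_iff hq.ne_zero] at h1
    subst h1
    simp only [zero_smul, add_zero] at h ⊢
    exact ⟨hd, fun e he => h e ⟨e, he, 0, by simp⟩⟩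
  · rintro ⟨hy, h⟩
    refine ⟨⟨y, hy, 0, by simp⟩, ?_⟩
    rintro _ ⟨e, he, c, rfl⟩
    rw [hermitianInner_add_left, hermitianInner_smul_left, h e he, hxD y hy, mul_zero, add_zero]

theorem hermitianHull_sup_of_isotropic {hq : IsPrimePow q} {hF : Nat.card F = q ^ 2}
    {D : Submodule F (Fin n → F)} {z : Fin n → F} (hz : hermitianInner q z z = 0)
    (hD : z ∈ hermitianDual hq hF D) :
    hermitianHull hq hF (D ⊔ span F {z}) = hermitianHull hq hF D ⊔ span F {z} := by
  have hzD : ∀ d ∈ D, hermitianInner q z d = 0 := fun d hd =>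
    (hermitianInner_eq_zero_comm hq hF).1 (hD d hd)
  ext y
  simp only [mem_hermitianHull, mem_sup_span_singleton']
  constructor
  · rintro ⟨⟨d, hd, c, rfl⟩, h⟩
    refine ⟨d, ⟨hd, fun e he => ?_⟩, c, rfl⟩
    have h1 := h e ⟨e, he, 0, by simp⟩
    rwa [hermitianInner_add_right hq hF, hermitianInner_smul_right hq hF, hD e he, mul_zero,
      add_zero] at h1
  · rintro ⟨d, ⟨hd, h⟩, c, rfl⟩
    refine ⟨⟨d, hd, c, rfl⟩, ?_⟩
    rintro _ ⟨e, he, c', rfl⟩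
    simp [hermitianInner_add_left, hermitianInner_smul_left, hermitianInner_add_right hq hF,
      hermitianInner_smul_right hq hF, h e he, hzD d hd, hz, hD e he]

/-! ### Cardinalities of subtypes -/

theorem natCard_and_add_natCard_and_not {α : Type*} [Finite α] (P Q : α → Prop) :
    Nat.card {a // P a ∧ Q a} + Nat.card {a // P a ∧ ¬ Q a} = Nat.card {a // P a} := by
  classical
  have := Fintype.ofFinite α
  simp only [Nat.card_eq_fintype_card, Fintype.card_subtype, ← Finset.filter_filter]
  exact Finset.card_filter_add_card_filter_not _

/-- Counting pairs by their first entry. The factor `c` allows a closed formula with denominator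
`c` for the number of second entries. -/
theorem mul_natCard_prod {α β : Type*} [Finite α] [Finite β] {P : α → Prop} {R : α → β → Prop}
    {c m : ℤ} (h : ∀ a, P a → c * Nat.card {b // R a b} = m) :
    c * Nat.card {p : α × β // P p.1 ∧ R p.1 p.2} = Nat.card {a // P a} * m := by
  let e : {p : α × β // P p.1 ∧ R p.1 p.2} ≃ Σ a : {a // P a}, {b // R a b} :=
    { toFun := fun p => ⟨⟨p.1.1, p.2.1⟩, ⟨p.1.2, p.2.2⟩⟩
      invFun := fun s => ⟨(s.1, s.2), s.1.2, s.2.2⟩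
      left_inv := fun _ => rfl
      right_inv := fun _ => rfl }
  have := Fintype.ofFinite {a // P a}
  rw [Nat.card_congr e, Nat.card_sigma, Nat.cast_sum, Finset.mul_sum,
    Finset.sum_congr rfl fun (a : {a // P a}) _ => h a.1 a.2]
  simp

theorem natCard_prod_eq_mul {α β : Type*} [Finite α] [Finite β] {P : α → Prop} {R : α → β → Prop}
    {m : ℕ} (h : ∀ a, P a → Nat.card {b // R a b} = m) :
    Nat.card {p : α × β // P p.1 ∧ R p.1 p.2} = Nat.card {a // P a} * m := by
  have := mul_natCard_prod (P := P) (R := R) (c := 1) (m := m) fun a ha => by rw [h a ha, one_mul]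
  rw [one_mul] at this
  exact_mod_cast this

/-! ### The norm `c ↦ c ^ (q + 1)` -/

theorem exists_pow_ne_self (hq : IsPrimePow q) (hF : Nat.card F = q ^ 2) : ∃ c : F, c ^ q ≠ c := by
  have := finite_of_natCard_eq_sq hq hF
  have := Fintype.ofFinite F
  by_contra! h
  have h1 : ∀ u : Fˣ, u ^ (q - 1) = 1 := fun u => by
    rw [← mul_left_inj u, pow_sub_one_mul hq.ne_zero, one_mul]
    exact Units.ext (by simpa using h u)
  rw [FiniteField.forall_pow_eq_one_iff, ← Nat.card_eq_fintype_card, hF] at h1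
  have h2 := Nat.le_of_dvd (Nat.sub_pos_of_lt hq.one_lt) h1
  have h3 : q < q ^ 2 := lt_self_pow₀ hq.one_lt one_lt_two
  have := hq.one_lt
  omega

/-- Every nonzero element of the subfield with `q` elements is the norm of exactly `q + 1` elements:
in the cyclic group `Fˣ` of order `(q + 1) * (q - 1)`, the `(q + 1)`-st powers are
the elements killed by `q - 1`. -/
theorem natCard_norm_eq (hq : IsPrimePow q) (hF : Nat.card F = q ^ 2) {t : F} (ht : t ≠ 0)
    (htq : t ^ q = t) : Nat.card {c : F // c ^ (q + 1) = t} = q + 1 := by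
  have := finite_of_natCard_eq_sq hq hF
  have hcard : Nat.card Fˣ = (q + 1) * (q - 1) := by
    rw [Nat.card_units, hF, ← Nat.sq_sub_sq, one_pow]
  have hq1 : 0 < q - 1 := Nat.sub_pos_of_lt hq.one_lt
  have hrange : (powMonoidHom (q + 1) : Fˣ →* Fˣ).range =
      (powMonoidHom (q - 1) : Fˣ →* Fˣ).ker := by
    apply Subgroup.eq_of_le_of_card_ge
    · rintro _ ⟨u, rfl⟩
      rw [MonoidHom.mem_ker, powMonoidHom_apply, powMonoidHom_apply, ← pow_mul, ← hcard,
        pow_card_eq_one']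
    · rw [IsCyclic.card_powMonoidHom_ker, IsCyclic.card_powMonoidHom_range, hcard,
        Nat.gcd_mul_left_left, Nat.gcd_mul_right_left, Nat.mul_div_cancel_left _ q.succ_pos]
  have hmem : Units.mk0 t ht ∈ (powMonoidHom (q + 1) : Fˣ →* Fˣ).range := by
    rw [hrange, MonoidHom.mem_ker, powMonoidHom_apply, ← mul_left_inj (Units.mk0 t ht),
      pow_sub_one_mul hq.ne_zero, one_mul]
    exact Units.ext (by simpa using htq)
  obtain ⟨u, hu⟩ := hmem
  have hker : Nat.card (powMonoidHom (q + 1) : Fˣ →* Fˣ).ker = q + 1 := by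
    rw [IsCyclic.card_powMonoidHom_ker, hcard, Nat.gcd_mul_right_left]
  have hmem (c : Fˣ) : c / u ∈ (powMonoidHom (q + 1) : Fˣ →* Fˣ).ker ↔ (c : F) ^ (q + 1) = t := by
    rw [MonoidHom.mem_ker, map_div, div_eq_one, hu, powMonoidHom_apply, Units.ext_iff,
      Units.val_pow_eq_pow_val, Units.val_mk0]
  have hne {c : F} (hc : c ^ (q + 1) = t) : c ≠ 0 := by
    rintro rfl
    exact ht (by rw [← hc, zero_pow q.succ_ne_zero])
  let e : {c : F // c ^ (q + 1) = t} ≃ (powMonoidHom (q + 1) : Fˣ →* Fˣ).ker :=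
    { toFun := fun c => ⟨Units.mk0 c.1 (hne c.2) / u, (hmem _).2 c.2⟩
      invFun := fun k => ⟨(k * u : Fˣ), (hmem _).1 (by rw [mul_div_cancel_right]; exact k.2)⟩
      left_inv := fun c => Subtype.ext (by simp)
      right_inv := fun k => Subtype.ext (Units.ext (by simp)) }
  rw [Nat.card_congr e, hker]

/-! ### Counting isotropic and nonisotropic vectors -/

/-- The number of vectors `x` of the code `C` with `⟨x, x⟩_H ≠ 0`. -/
noncomputable def nonisotropicCount (q : ℕ) (C : Submodule F (Fin n → F)) : ℕ :=
  Nat.card {x : Fin n → F // x ∈ C ∧ ¬ hermitianInner q x x = 0}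

/-- The number of vectors `x` of the code `C` with `⟨x, x⟩_H = 0`. -/
noncomputable def isotropicCount (q : ℕ) (C : Submodule F (Fin n → F)) : ℕ :=
  Nat.card {x : Fin n → F // x ∈ C ∧ hermitianInner q x x = 0}

theorem isotropicCount_add_nonisotropicCount (hq : IsPrimePow q) (hF : Nat.card F = q ^ 2)
    (C : Submodule F (Fin n → F)) :
    isotropicCount q C + nonisotropicCount q C = (q ^ 2) ^ finrank F C := by
  have := finite_of_natCard_eq_sq hq hF
  rw [isotropicCount, nonisotropicCount, natCard_and_add_natCard_and_not]
  exact natCard_submodule hF C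

/-- Polarization: a code all of whose vectors are isotropic is contained in its dual. -/
theorem exists_nonisotropic {hq : IsPrimePow q} {hF : Nat.card F = q ^ 2}
    {C : Submodule F (Fin n → F)} (hC : hermitianHull hq hF C ≠ C) :
    ∃ x ∈ C, hermitianInner q x x ≠ 0 := by
  by_contra! h
  refine hC (le_antisymm inf_le_left fun v hv => ⟨hv, fun u hu => ?_⟩)
  obtain ⟨c, hc⟩ := exists_pow_ne_self hq hF
  have h1 := h (u + v) (add_mem hu hv)
  have h2 := h (c • u + v) (add_mem (smul_mem _ c hu) hv)
  simp only [hermitianInner_add_left, hermitianInner_add_right hq hF, hermitianInner_smul_left,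
    hermitianInner_smul_right hq hF, h u hu, h v hv] at h1 h2
  have h3 : (c ^ q - c) * hermitianInner q u v = 0 := by linear_combination c ^ q * h1 - h2
  exact (mul_eq_zero.1 h3).resolve_left (sub_ne_zero.2 hc)

/-- Writing the vectors of `D ⊕ F x` as `d + c x`, one of them is isotropic iff the norm of `c` is
`-⟨d, d⟩ / ⟨x, x⟩`; this holds for one `c` if `d` is isotropic and for `q + 1` of them otherwise. -/
theorem isotropicCount_sup_span_singleton {hq : IsPrimePow q} {hF : Nat.card F = q ^ 2}
    {D : Submodule F (Fin n → F)} {x : Fin n → F} (hx : hermitianInner q x x ≠ 0)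
    (hD : x ∈ hermitianDual hq hF D) :
    isotropicCount q (D ⊔ span F {x}) = isotropicCount q D + nonisotropicCount q D * (q + 1) := by
  have := finite_of_natCard_eq_sq hq hF
  have hxD : ∀ d ∈ D, hermitianInner q x d = 0 := fun d hd =>
    (hermitianInner_eq_zero_comm hq hF).1 (hD d hd)
  have hnorm (d : Fin n → F) (hd : d ∈ D) (c : F) : hermitianInner q (d + c • x) (d + c • x) =
      hermitianInner q d d + c ^ (q + 1) * hermitianInner q x x := by
    simp only [hermitianInner_add_left, hermitianInner_add_right hq hF, hermitianInner_smul_left,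
      hermitianInner_smul_right hq hF, hD d hd, hxD d hd]
    ring
  let S : (Fin n → F) × F → Prop := fun p =>
    p.1 ∈ D ∧ hermitianInner q p.1 p.1 + p.2 ^ (q + 1) * hermitianInner q x x = 0
  have hbij : isotropicCount q (D ⊔ span F {x}) = Nat.card {p // S p} := by
    refine (Nat.card_congr (Equiv.ofBijective (fun p : {p // S p} =>
      ⟨p.1.1 + p.1.2 • x, mem_sup_span_singleton'.2 ⟨_, p.2.1, _, rfl⟩,
        (hnorm _ p.2.1 _).trans p.2.2⟩) ⟨?_, ?_⟩)).symm
    · rintro ⟨⟨d, c⟩, hd, hc⟩ ⟨⟨d', c'⟩, hd', hc'⟩ h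
      simp only [Subtype.mk.injEq, Prod.mk.injEq] at h hd hd' ⊢
      have h1 := congrArg (fun y => hermitianInner q y x) h
      simp only [hermitianInner_add_left, hermitianInner_smul_left, hD d hd, hD d' hd', zero_add,
        mul_left_inj' hx] at h1
      subst h1
      exact ⟨add_right_cancel h, rfl⟩
    · rintro ⟨y, hy, hy0⟩
      obtain ⟨d, hd, c, rfl⟩ := mem_sup_span_singleton'.1 hy
      exact ⟨⟨(d, c), hd, by rw [← hnorm d hd, hy0]⟩, rfl⟩
  rw [hbij, ← natCard_and_add_natCard_and_not S fun p => hermitianInner q p.1 p.1 = 0]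
  congr 1
  · rw [isotropicCount, ← mul_one (Nat.card {d // d ∈ D ∧ hermitianInner q d d = 0}),
      ← natCard_prod_eq_mul (β := F)
      (R := fun d c => hermitianInner q d d + c ^ (q + 1) * hermitianInner q x x = 0)]
    · exact Nat.card_congr (Equiv.subtypeEquivRight fun p => by simp only [S]; tauto)
    · rintro d ⟨-, hd⟩
      rw [Nat.card_eq_one_iff_unique]
      simp only [hd, zero_add, mul_eq_zero, or_iff_left hx, pow_eq_zero_iff q.succ_ne_zero]
      exact ⟨inferInstance, inferInstance⟩
  · rw [nonisotropicCount, ← natCard_prod_eq_mul (β := F)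
      (R := fun d c => hermitianInner q d d + c ^ (q + 1) * hermitianInner q x x = 0)]
    · exact Nat.card_congr (Equiv.subtypeEquivRight fun p => by simp only [S]; tauto)
    · rintro d ⟨-, hd⟩
      have hneg : (-hermitianInner q d d) ^ q = -hermitianInner q d d := by
        have := map_neg (conjEquiv hq hF) (hermitianInner q d d)
        change (-hermitianInner q d d) ^ q = -(hermitianInner q d d ^ q) at this
        rw [this, hermitianInner_conj hq hF]
      have hcard := natCard_norm_eq hq hF (div_ne_zero (neg_ne_zero.2 hd) hx)
        (by rw [div_pow, hneg, hermitianInner_conj hq hF])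
      refine (Nat.card_congr (Equiv.subtypeEquivRight fun c => ?_)).trans hcard
      rw [eq_div_iff hx, eq_neg_iff_add_eq_zero, add_comm]

/-- The number of nonisotropic vectors of a code of dimension `l + a` with hull of dimension `l`. It
is stated with an extra factor `q`, which avoids the exponent `a - 1`. -/
theorem nonisotropicCount_formula (hq : IsPrimePow q) (hF : Nat.card F = q ^ 2) {l : ℕ} (a : ℕ)
    (C : Submodule F (Fin n → F)) (hl : finrank F (hermitianHull hq hF C) = l)
    (hC : finrank F C = l + a) :
    (q * nonisotropicCount q C : ℤ) =
      (q : ℤ) ^ (2 * l) * (q - 1) * (q ^ a * (q ^ a - (-1) ^ a)) := by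
  have := finite_of_natCard_eq_sq hq hF
  induction a generalizing C with
  | zero =>
    have hCC : hermitianHull hq hF C = C := eq_of_le_of_finrank_eq inf_le_left (by rw [hl, hC]; rfl)
    have : IsEmpty {x : Fin n → F // x ∈ C ∧ ¬ hermitianInner q x x = 0} :=
      ⟨fun ⟨x, hx, hx0⟩ => hx0 ((hCC.ge hx).2 x hx)⟩
    simp [nonisotropicCount]
  | succ a ih =>
    have hne : hermitianHull hq hF C ≠ C := fun h => by rw [h] at hl; omega
    obtain ⟨x, hxC, hx⟩ := exists_nonisotropic hne
    let D := C ⊓ hermitianDual hq hF (span F {x})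
    have hDx : D ≤ hermitianDual hq hF (span F {x}) := inf_le_right
    have hsup : D ⊔ span F {x} = C := inf_hermitianDual_sup_span_singleton hq hF hx hxC
    have hxD := le_hermitianDual_span_singleton.1 hDx
    have hfin := finrank_sup_span_singleton_of_inner_ne_zero hx hDx
    have hhull := hermitianHull_sup_of_nonisotropic hx hxD
    have hcount := isotropicCount_sup_span_singleton hx hxD
    rw [hsup] at hfin hhull hcount
    have hD := ih D (by rw [← hhull, hl]) (by omega)
    have h1 := isotropicCount_add_nonisotropicCount hq hF C
    have h2 := isotropicCount_add_nonisotropicCount hq hF D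
    rw [hcount, hC] at h1
    rw [show finrank F D = l + a by omega] at h2
    zify at h1 h2
    have h4 : ((-1 : ℤ) ^ a) * (-1) ^ a = 1 := by rw [← mul_pow]; simp
    have h3 : (nonisotropicCount q C : ℤ) =
        (q ^ 2) ^ (l + (a + 1)) - (q ^ 2) ^ (l + a) - q * nonisotropicCount q D := by
      linear_combination h1 - h2
    rw [h3, hD]
    ring

/-! ### Double counting -/

/-- For `⟨z, w⟩_H ≠ 0`, the maps `D ↦ D + F z` and `C ↦ C ∩ w^⊥` are inverse bijections between the
codes contained in `w^⊥` and the codes containing `z`. -/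
theorem natCard_code_pairs (hq : IsPrimePow q) (hF : Nat.card F = q ^ 2) {ι : Type*}
    (z w : ι → Fin n → F) {P Q : Submodule F (Fin n → F) → ι → Prop}
    (hP : ∀ D i, P D i → hermitianInner q (z i) (w i) ≠ 0 ∧ D ≤ hermitianDual hq hF (span F {w i}))
    (hQ : ∀ C i, Q C i → hermitianInner q (z i) (w i) ≠ 0 ∧ z i ∈ C)
    (hPQ : ∀ D i, hermitianInner q (z i) (w i) ≠ 0 → D ≤ hermitianDual hq hF (span F {w i}) →
      (P D i ↔ Q (D ⊔ span F {z i}) i)) :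
    Nat.card {p : Submodule F (Fin n → F) × ι // P p.1 p.2} =
      Nat.card {p : Submodule F (Fin n → F) × ι // Q p.1 p.2} :=
  Nat.card_congr
    { toFun := fun p => ⟨(p.1.1 ⊔ span F {z p.1.2}, p.1.2),
        (hPQ _ _ (hP _ _ p.2).1 (hP _ _ p.2).2).1 p.2⟩
      invFun := fun p => ⟨(p.1.1 ⊓ hermitianDual hq hF (span F {w p.1.2}), p.1.2),
        (hPQ _ _ (hQ _ _ p.2).1 inf_le_right).2 (by
          rw [inf_hermitianDual_sup_span_singleton hq hF (hQ _ _ p.2).1 (hQ _ _ p.2).2]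
          exact p.2)⟩
      left_inv := fun p => Subtype.ext (Prod.ext
        (sup_span_singleton_inf_hermitianDual hq hF (hP _ _ p.2).1 (hP _ _ p.2).2) rfl)
      right_inv := fun p => Subtype.ext (Prod.ext
        (inf_hermitianDual_sup_span_singleton hq hF (hQ _ _ p.2).1 (hQ _ _ p.2).2) rfl) }

/-- Counting pairs of a `(k + 1)`-dimensional code `C` with hull of dimension `l` and a nonisotropic
`x ∈ C`, where `k = l + a`: removing `x` leaves the code `D = C ∩ x^⊥` with the same hull, and `x`
is a nonisotropic vector of `D^⊥`. -/
theorem hermitianHullCount_succ_dim (hq : IsPrimePow q) (hF : Nat.card F = q ^ 2) {l a b : ℕ}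
    (hn : n = 2 * l + a + b) :
    (hermitianHullCount hq hF n (l + a + 1) l : ℤ) *
        (q ^ (a + 1) * (q ^ (a + 1) - (-1) ^ (a + 1))) =
      hermitianHullCount hq hF n (l + a) l * (q ^ b * (q ^ b - (-1) ^ b)) := by
  have := finite_of_natCard_eq_sq hq hF
  have hpairs := natCard_code_pairs (n := n) hq hF (fun x => x) (fun x => x)
    (P := fun D x => (finrank F D = l + a ∧ finrank F (hermitianHull hq hF D) = l) ∧
      (x ∈ hermitianDual hq hF D ∧ ¬ hermitianInner q x x = 0))
    (Q := fun C x => (finrank F C = l + a + 1 ∧ finrank F (hermitianHull hq hF C) = l) ∧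
      (x ∈ C ∧ ¬ hermitianInner q x x = 0))
    (fun D x h => ⟨h.2.2, le_hermitianDual_span_singleton.2 h.2.1⟩) (fun C x h => ⟨h.2.2, h.2.1⟩)
    (fun D x hx hD => by
      have hxD := le_hermitianDual_span_singleton.1 hD
      rw [finrank_sup_span_singleton_of_inner_ne_zero hx hD,
        hermitianHull_sup_of_nonisotropic hx hxD, add_left_inj]
      have : x ∈ D ⊔ span F {x} := mem_sup_right (mem_span_singleton_self x)
      tauto)
  have hD := mul_natCard_prod
    (P := fun D : Submodule F (Fin n → F) =>
      finrank F D = l + a ∧ finrank F (hermitianHull hq hF D) = l)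
    (R := fun D x => x ∈ hermitianDual hq hF D ∧ ¬ hermitianInner q x x = 0)
    (c := q) fun D h => nonisotropicCount_formula hq hF (l := l) b (hermitianDual hq hF D)
      (by rw [hermitianHull_hermitianDual, h.2]) (by rw [finrank_hermitianDual, h.1]; omega)
  have hC := mul_natCard_prod
    (P := fun C : Submodule F (Fin n → F) =>
      finrank F C = l + a + 1 ∧ finrank F (hermitianHull hq hF C) = l)
    (R := fun C x => x ∈ C ∧ ¬ hermitianInner q x x = 0)
    (c := q) fun C h => nonisotropicCount_formula hq hF (l := l) (a + 1) C h.2 h.1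
  rw [← hpairs, hD] at hC
  have hq1 : (1 : ℤ) < q := by exact_mod_cast hq.one_lt
  have hne : (q : ℤ) ^ (2 * l) * (q - 1) ≠ 0 := mul_ne_zero (by positivity) (by linarith)
  refine mul_left_cancel₀ hne ?_
  simp only [hermitianHullCount]
  linear_combination -hC

/-- The vectors of `E` orthogonal to `z` form a subspace of codimension one. -/
theorem mul_natCard_inner_ne_zero (hq : IsPrimePow q) (hF : Nat.card F = q ^ 2)
    {E : Submodule F (Fin n → F)} {z : Fin n → F} (hz : z ∉ hermitianDual hq hF E) :
    (q ^ 2 : ℤ) * Nat.card {w // w ∈ E ∧ ¬ hermitianInner q z w = 0} =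
      (q ^ 2 - 1) * (q ^ 2) ^ finrank F E := by
  have := finite_of_natCard_eq_sq hq hF
  rw [mem_hermitianDual] at hz
  push Not at hz
  obtain ⟨w, hw, hwz⟩ := hz
  have h1 := finrank_sup_span_singleton_of_inner_ne_zero hwz
    (inf_le_right (a := E) (b := hermitianDual hq hF (span F {z})))
  rw [inf_hermitianDual_sup_span_singleton hq hF hwz hw] at h1
  have h2 := natCard_and_add_natCard_and_not (fun w => w ∈ E) fun w => hermitianInner q z w = 0
  have h3 : Nat.card {w // w ∈ E ∧ hermitianInner q z w = 0} =
      Nat.card ↥(E ⊓ hermitianDual hq hF (span F {z})) :=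
    Nat.card_congr (Equiv.subtypeEquivRight fun w => by
      rw [mem_inf, mem_hermitianDual_span_singleton])
  have h4 : Nat.card {w // w ∈ E} = (q ^ 2) ^ finrank F E := natCard_submodule hF E
  rw [h3, h4, natCard_submodule hF, h1] at h2
  rw [h1]
  zify at h2
  linear_combination (q ^ 2 : ℤ) * h2

/-- The number of isotropic vectors of `D^⊥` outside `D`, for `D^⊥` of dimension `l + b`: the
isotropic vectors of `D^⊥` that lie in `D` make up the hull of `D`. -/
theorem mul_natCard_isotropic_dual (hq : IsPrimePow q) (hF : Nat.card F = q ^ 2) {l b : ℕ}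
    {D : Submodule F (Fin n → F)} (hl : finrank F (hermitianHull hq hF D) = l)
    (hb : finrank F (hermitianDual hq hF D) = l + b) :
    (q : ℤ) * Nat.card {z // (z ∈ hermitianDual hq hF D ∧ hermitianInner q z z = 0) ∧ z ∉ D} =
      q ^ (2 * l) * ((q ^ b - (-1) ^ b) * (q ^ b + q * (-1) ^ b)) := by
  have := finite_of_natCard_eq_sq hq hF
  have h1 := natCard_and_add_natCard_and_not
    (fun z => z ∈ hermitianDual hq hF D ∧ hermitianInner q z z = 0) fun z => z ∈ D
  have h2 : Nat.card {z // (z ∈ hermitianDual hq hF D ∧ hermitianInner q z z = 0) ∧ z ∈ D} =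
      (q ^ 2) ^ l := by
    rw [← hl, ← natCard_submodule hF]
    refine Nat.card_congr (Equiv.subtypeEquivRight fun z => ?_)
    exact ⟨fun h => ⟨h.2, h.1.1⟩, fun h => ⟨⟨h.2, h.2 z h.1⟩, h.1⟩⟩
  have h3 := isotropicCount_add_nonisotropicCount hq hF (hermitianDual hq hF D)
  have h4 := nonisotropicCount_formula hq hF b _
    (by rw [hermitianHull_hermitianDual, hl]) hb
  rw [hb] at h3
  rw [h2] at h1
  change _ = isotropicCount q _ at h1
  have h5 : ((-1 : ℤ) ^ b) * (-1) ^ b = 1 := by rw [← mul_pow]; simp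
  zify at h1 h3
  linear_combination (q : ℤ) * h1 + q * h3 - h4 + (q : ℤ) ^ (2 * l) * q * h5

/-- Counting triples of a `(k + 1)`-dimensional code `C` with hull of dimension `l + 1`, a nonzero
`z` in its hull and a vector `w` with `⟨z, w⟩_H ≠ 0`, where `k = l + a`: the code `D = C ∩ w^⊥` has
a hull of dimension `l`, and `z` and `w` lie in `D^⊥`, with `z` isotropic and outside `D`. -/
theorem hermitianHullCount_succ_succ (hq : IsPrimePow q) (hF : Nat.card F = q ^ 2) {l a b : ℕ}
    (hn : n = 2 * l + a + b) :
    (hermitianHullCount hq hF n (l + a + 1) (l + 1) : ℤ) *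
        (q ^ (2 * a + 1) * (q ^ (2 * l + 2) - 1)) =
      hermitianHullCount hq hF n (l + a) l * ((q ^ b - (-1) ^ b) * (q ^ b + q * (-1) ^ b)) := by
  have := finite_of_natCard_eq_sq hq hF
  have hpairs := natCard_code_pairs (n := n) hq hF Prod.fst Prod.snd
    (P := fun D p => (finrank F D = l + a ∧ finrank F (hermitianHull hq hF D) = l) ∧
      (((p.1 ∈ hermitianDual hq hF D ∧ hermitianInner q p.1 p.1 = 0) ∧ p.1 ∉ D) ∧
        (p.2 ∈ hermitianDual hq hF D ∧ ¬ hermitianInner q p.1 p.2 = 0)))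
    (Q := fun C p => (finrank F C = l + a + 1 ∧ finrank F (hermitianHull hq hF C) = l + 1) ∧
      ((p.1 ∈ hermitianHull hq hF C ∧ ¬ p.1 = 0) ∧
        (p.2 ∈ (⊤ : Submodule F (Fin n → F)) ∧ ¬ hermitianInner q p.1 p.2 = 0)))
    (fun D p h => ⟨h.2.2.2, le_hermitianDual_span_singleton.2 h.2.2.1⟩)
    (fun C p h => ⟨h.2.2.2, h.2.1.1.1⟩)
    (fun D ⟨z, w⟩ hzw hD => by
      have hwD := le_hermitianDual_span_singleton.1 hD
      simp only at hzw hD hwD ⊢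
      have hzD : z ∉ D := fun h => hzw (hwD z h)
      have hz0 : z ≠ 0 := fun h => hzD (h ▸ zero_mem D)
      have hzmem : z ∈ D ⊔ span F {z} := mem_sup_right (mem_span_singleton_self z)
      have hhull : z ∈ hermitianHull hq hF (D ⊔ span F {z}) ↔
          z ∈ hermitianDual hq hF D ∧ hermitianInner q z z = 0 := by
        refine ⟨fun h => ⟨fun d hd => h.2 d (mem_sup_left hd), h.2 z hzmem⟩, fun h => ?_⟩
        rw [hermitianHull_sup_of_isotropic h.2 h.1]
        exact mem_sup_right (mem_span_singleton_self z)
      rw [finrank_sup_span_singleton_of_inner_ne_zero hzw hD, add_left_inj, hhull]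
      simp only [hzw, hzD, hz0, hwD, mem_top, not_false_eq_true, and_true]
      refine and_congr_left fun h => and_congr_right fun _ => ?_
      rw [hermitianHull_sup_of_isotropic h.2 h.1,
        finrank_sup_span_singleton (fun h' => hzD (mem_hermitianHull.1 h').1), add_left_inj])
  have hD := mul_natCard_prod
    (P := fun D : Submodule F (Fin n → F) =>
      finrank F D = l + a ∧ finrank F (hermitianHull hq hF D) = l)
    (R := fun D (p : (Fin n → F) × (Fin n → F)) =>
      ((p.1 ∈ hermitianDual hq hF D ∧ hermitianInner q p.1 p.1 = 0) ∧ p.1 ∉ D) ∧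
        (p.2 ∈ hermitianDual hq hF D ∧ ¬ hermitianInner q p.1 p.2 = 0))
    (c := q * q ^ 2)
    (m := q ^ (2 * l) * ((q ^ b - (-1) ^ b) * (q ^ b + q * (-1) ^ b)) *
      ((q ^ 2 - 1) * (q ^ 2) ^ (l + b))) fun D h => by
      have hdim : finrank F (hermitianDual hq hF D) = l + b := by
        rw [finrank_hermitianDual, h.1]; omega
      have h1 := mul_natCard_prod
        (P := fun z => (z ∈ hermitianDual hq hF D ∧ hermitianInner q z z = 0) ∧ z ∉ D)
        (R := fun z w => w ∈ hermitianDual hq hF D ∧ ¬ hermitianInner q z w = 0)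
        (c := q ^ 2) fun z hz => mul_natCard_inner_ne_zero hq hF
          (by rw [hermitianDual_hermitianDual]; exact hz.2)
      rw [hdim] at h1
      rw [mul_assoc, h1, ← mul_assoc, mul_natCard_isotropic_dual hq hF h.2 hdim]
  have hC := mul_natCard_prod
    (P := fun C : Submodule F (Fin n → F) =>
      finrank F C = l + a + 1 ∧ finrank F (hermitianHull hq hF C) = l + 1)
    (R := fun C (p : (Fin n → F) × (Fin n → F)) => (p.1 ∈ hermitianHull hq hF C ∧ ¬ p.1 = 0) ∧
        (p.2 ∈ (⊤ : Submodule F (Fin n → F)) ∧ ¬ hermitianInner q p.1 p.2 = 0))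
    (c := q ^ 2)
    (m := ((q ^ 2) ^ (l + 1) - 1) * ((q ^ 2 - 1) * (q ^ 2) ^ n)) fun C h => by
      have h1 := mul_natCard_prod
        (P := fun z => z ∈ hermitianHull hq hF C ∧ ¬ z = 0)
        (R := fun z w => w ∈ (⊤ : Submodule F (Fin n → F)) ∧ ¬ hermitianInner q z w = 0)
        (c := q ^ 2) fun z hz => mul_natCard_inner_ne_zero hq hF (by
          have h0 : hermitianDual hq hF (⊤ : Submodule F (Fin n → F)) = ⊥ := by
            rw [← finrank_eq_zero, finrank_hermitianDual, finrank_top, finrank_fin_fun,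
              Nat.sub_self]
          rw [h0, mem_bot]
          exact hz.2)
      have h2 := natCard_and_add_natCard_and_not (fun z => z ∈ hermitianHull hq hF C) (· = 0)
      have h3 : Nat.card {z // z ∈ hermitianHull hq hF C ∧ z = 0} = 1 := by
        rw [Nat.card_eq_one_iff_unique]
        exact ⟨⟨fun x y => Subtype.ext (x.2.2.trans y.2.2.symm)⟩, ⟨⟨0, zero_mem _, rfl⟩⟩⟩
      have h4 : Nat.card {z // z ∈ hermitianHull hq hF C} = (q ^ 2) ^ (l + 1) := by
        rw [← h.2]; exact natCard_submodule hF _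
      rw [h3, h4] at h2
      zify at h2
      rw [finrank_top, finrank_fin_fun] at h1
      rw [h1, ← h2, add_sub_cancel_left]
  rw [← hpairs] at hC
  have hq1 : (1 : ℤ) < q := by exact_mod_cast hq.one_lt
  have hq2 : (q : ℤ) ^ 2 - 1 ≠ 0 := by nlinarith
  have hne : (q : ℤ) ^ (2 * l) * ((q ^ 2 - 1) * (q ^ 2) ^ (l + b)) ≠ 0 :=
    mul_ne_zero (by positivity) (mul_ne_zero hq2 (by positivity))
  refine mul_left_cancel₀ hne ?_
  simp only [hermitianHullCount]
  rw [mul_assoc, hC] at hD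
  subst hn
  linear_combination hD

/-! ### Comparing the counts -/

/-- The two double counts compare the codes of dimension `l + a + 1` with hulls of dimension `l` and
`l + 1` through the codes of dimension `l + a` with hull of dimension `l`. -/
theorem hermitianHullCount_succ_hull (hq : IsPrimePow q) (hF : Nat.card F = q ^ 2) {l a b : ℕ}
    (hn : n = 2 * l + a + (b + 1)) :
    (hermitianHullCount hq hF n (l + a + 1) (l + 1) : ℤ) *
        (q ^ (a + b) * (q ^ (2 * l + 2) - 1)) =
      hermitianHullCount hq hF n (l + a + 1) l *
        ((q ^ (a + 1) - (-1) ^ (a + 1)) * (q ^ b - (-1) ^ b)) := by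
  have h1 := hermitianHullCount_succ_dim hq hF hn
  have h2 := hermitianHullCount_succ_succ hq hF hn
  have hq0 : (q : ℤ) ≠ 0 := by exact_mod_cast hq.ne_zero
  refine mul_left_cancel₀ (pow_ne_zero (a + 2) hq0) ?_
  linear_combination (q : ℤ) ^ (b + 1) * h2 - (q : ℤ) * (q ^ b - (-1) ^ b) * h1

theorem pow_sub_neg_one_pow_pos {q : ℕ} (hq : 1 < q) (a : ℕ) (ha : a ≠ 0) :
    (0 : ℤ) < q ^ a - (-1) ^ a := by
  have h : (1 : ℤ) < q ^ a := one_lt_pow₀ (by exact_mod_cast hq) ha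
  rcases neg_one_pow_eq_or ℤ a with h' | h' <;> rw [h'] <;> linarith

theorem hermitianHullCount_zero_zero (hq : IsPrimePow q) (hF : Nat.card F = q ^ 2) :
    0 < hermitianHullCount hq hF n 0 0 := by
  have := finite_of_natCard_eq_sq hq hF
  refine Nat.card_pos_iff.2 ⟨⟨⟨⊥, finrank_bot F _, ?_⟩⟩, inferInstance⟩
  rw [hermitianHull, bot_inf_eq, finrank_bot]

/-- Both recursions have positive coefficients, so every count in their range is positive. -/
theorem hermitianHullCount_pos (hq : IsPrimePow q) (hF : Nat.card F = q ^ 2) (l a b : ℕ)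
    (hn : n = 2 * l + a + b) : 0 < hermitianHullCount hq hF n (l + a) l := by
  have hq1 : (1 : ℤ) < q := by exact_mod_cast hq.one_lt
  induction l generalizing a b with
  | zero =>
    induction a generalizing b with
    | zero => exact hermitianHullCount_zero_zero hq hF
    | succ a ih =>
      have h := hermitianHullCount_succ_dim (n := n) hq hF (l := 0) (a := a) (b := b + 1) (by omega)
      have h1 : (0 : ℤ) < hermitianHullCount hq hF n (0 + a) 0 := by
        exact_mod_cast ih (b + 1) (by omega)
      have h2 := pow_sub_neg_one_pow_pos hq.one_lt (b + 1) b.succ_ne_zero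
      have h3 := pow_sub_neg_one_pow_pos hq.one_lt (a + 1) a.succ_ne_zero
      have h4 : (0 : ℤ) < hermitianHullCount hq hF n (0 + a + 1) 0 := by
        refine pos_of_mul_pos_left (b := (q : ℤ) ^ (a + 1) * (q ^ (a + 1) - (-1) ^ (a + 1))) ?_
          (by positivity)
        rw [h]
        positivity
      exact_mod_cast h4
  | succ l ih =>
    have h := hermitianHullCount_succ_hull (n := n) hq hF (l := l) (a := a) (b := b + 1) (by omega)
    have h1 : (0 : ℤ) < hermitianHullCount hq hF n (l + a + 1) l := by
      exact_mod_cast ih (a + 1) (b + 1) (by omega)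
    have h2 := pow_sub_neg_one_pow_pos hq.one_lt (b + 1) b.succ_ne_zero
    have h3 := pow_sub_neg_one_pow_pos hq.one_lt (a + 1) a.succ_ne_zero
    have h5 : (0 : ℤ) < q ^ (2 * l + 2) - 1 :=
      sub_pos.2 (one_lt_pow₀ hq1 (by omega))
    have h4 : (0 : ℤ) < hermitianHullCount hq hF n (l + a + 1) (l + 1) := by
      refine pos_of_mul_pos_left (b := (q : ℤ) ^ (a + (b + 1)) * (q ^ (2 * l + 2) - 1)) ?_
        (by positivity)
      rw [h]
      positivity
    rw [show l + 1 + a = l + a + 1 by omega]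
    exact_mod_cast h4

/-- If `q ≥ 3` or `l ≥ 1`, the crude bound `q ^ a + 1` for both factors suffices. -/
theorem factor_lt_of_generic {q l a b : ℕ} (hq : 1 < q) (h : 3 ≤ q ∨ 1 ≤ l) :
    ((q : ℤ) ^ (a + 1) - (-1) ^ (a + 1)) * (q ^ (b + 1) - (-1) ^ (b + 1)) <
      q ^ (a + (b + 1)) * (q ^ (2 * l + 2) - 1) := by
  have hq2 : (2 : ℤ) ≤ q := by exact_mod_cast hq
  have hA : (1 : ℤ) ≤ q ^ a := one_le_pow₀ (by linarith)
  have hB : (1 : ℤ) ≤ q ^ b := one_le_pow₀ (by linarith)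
  have hsa : -(-1 : ℤ) ^ (a + 1) ≤ q ^ a := by
    rcases neg_one_pow_eq_or ℤ (a + 1) with h' | h' <;> rw [h'] <;> linarith
  have hsb : -(-1 : ℤ) ^ (b + 1) ≤ q ^ b := by
    rcases neg_one_pow_eq_or ℤ (b + 1) with h' | h' <;> rw [h'] <;> linarith
  have hpos := (pow_sub_neg_one_pow_pos hq (b + 1) b.succ_ne_zero).le
  have hkey : ((q : ℤ) + 1) * (q + 1) < q * (q ^ (2 * l + 2) - 1) := by
    rcases h with h | h
    · have h3 : (3 : ℤ) ≤ q := by exact_mod_cast h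
      have : (q : ℤ) ^ 2 ≤ q ^ (2 * l + 2) := pow_le_pow_right₀ (by linarith) (by omega)
      nlinarith
    · have : (q : ℤ) ^ 4 ≤ q ^ (2 * l + 2) := pow_le_pow_right₀ (by linarith) (by omega)
      have h2 : (4 : ℤ) ≤ q ^ 2 := by nlinarith
      have h4 : (4 : ℤ) * q ^ 2 ≤ q ^ 4 := by nlinarith
      have h5 : 2 * ((q : ℤ) ^ (2 * l + 2) - 1) ≤ q * (q ^ (2 * l + 2) - 1) :=
        mul_le_mul_of_nonneg_right hq2 (by linarith)
      nlinarith
  calc ((q : ℤ) ^ (a + 1) - (-1) ^ (a + 1)) * (q ^ (b + 1) - (-1) ^ (b + 1))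
      ≤ (q ^ a * (q + 1)) * (q ^ b * (q + 1)) := by
        refine mul_le_mul ?_ ?_ hpos (by positivity)
        · linarith [pow_succ (q : ℤ) a]
        · linarith [pow_succ (q : ℤ) b]
    _ = q ^ a * q ^ b * ((q + 1) * (q + 1)) := by ring
    _ < q ^ a * q ^ b * (q * (q ^ (2 * l + 2) - 1)) :=
        mul_lt_mul_of_pos_left hkey (by positivity)
    _ = q ^ (a + (b + 1)) * (q ^ (2 * l + 2) - 1) := by ring

/-- The ratio `(2 ^ c - (-1) ^ c) / 2 ^ c` is less than `1` for even `c ≥ 2` and at most `9 / 8` for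
odd `c ≥ 3`; only `c = 1`, where it is `3 / 2`, is excluded. -/
theorem eight_mul_two_pow_sub_le {a : ℕ} (ha : a ≠ 0) :
    8 * ((2 : ℤ) ^ (a + 1) - (-1) ^ (a + 1)) ≤ 9 * 2 ^ (a + 1) := by
  rcases Nat.even_or_odd (a + 1) with h | h
  · rw [h.neg_one_pow]
    have : (0 : ℤ) < 2 ^ (a + 1) := by positivity
    linarith
  · rw [h.neg_one_pow]
    have h2 : 2 ≤ a := by
      rcases h with ⟨c, hc⟩
      omega
    have : (2 : ℤ) ^ 3 ≤ 2 ^ (a + 1) := pow_le_pow_right₀ one_le_two (by omega)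
    linarith

/-- For `q = 2` and `l = 0`, a factor with exponent `1` exceeds its power of two by the ratio
`3 / 2`, so the sign in the other factor decides; otherwise the bound `(9 / 8) ^ 2 < 3 / 2` does. -/
theorem two_pow_factor_lt {a b : ℕ} (h : ¬ ((a = 0 ∨ b = 0) ∧ Even (a + b))) :
    ((2 : ℤ) ^ (a + 1) - (-1) ^ (a + 1)) * (2 ^ (b + 1) - (-1) ^ (b + 1)) <
      2 ^ (a + (b + 1)) * 3 := by
  by_cases ha : a = 0
  · subst ha
    have hb : Even (b + 1) := by
      rw [Nat.even_add_one]
      simpa using h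
    rw [hb.neg_one_pow, zero_add, zero_add]
    linarith
  by_cases hb : b = 0
  · subst hb
    have ha : Even (a + 1) := by
      rw [Nat.even_add_one]
      simpa using h
    rw [ha.neg_one_pow, zero_add, pow_succ]
    linarith
  have h1 := eight_mul_two_pow_sub_le ha
  have h2 := eight_mul_two_pow_sub_le hb
  have h3 := pow_sub_neg_one_pow_pos one_lt_two (b + 1) b.succ_ne_zero
  push_cast at h3
  have h4 := mul_le_mul h1 h2 (by linarith) (by positivity)
  have h5 : (0 : ℤ) < 2 ^ (a + (b + 1)) := by positivity
  have h6 : (9 * 2 ^ (a + 1)) * (9 * 2 ^ (b + 1)) = 162 * (2 : ℤ) ^ (a + (b + 1)) := by ring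
  linarith

theorem lt_two_pow_factor {a b : ℕ} (h : a = 0 ∨ b = 0) (hab : Even (a + b)) :
    (2 : ℤ) ^ (a + (b + 1)) * 3 <
      (2 ^ (a + 1) - (-1) ^ (a + 1)) * (2 ^ (b + 1) - (-1) ^ (b + 1)) := by
  rcases h with rfl | rfl
  · rw [zero_add] at hab
    rw [hab.add_one.neg_one_pow, zero_add, zero_add]
    linarith
  · rw [add_zero] at hab
    rw [hab.add_one.neg_one_pow, zero_add]
    linarith

end

theorem corollary3p4 {F : Type*} [Field F] (q n k l : ℕ) (hq : IsPrimePow q)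
    (hF : Nat.card F = q ^ 2) (hl : l < min k (n - k)) :
    (¬ (q = 2 ∧ l = 0 ∧ (k = 1 ∨ k = n - 1) ∧ Even n) →
      hermitianHullCount hq hF n k l > hermitianHullCount hq hF n k (l + 1)) ∧
    ((q = 2 ∧ l = 0 ∧ (k = 1 ∨ k = n - 1) ∧ Even n) →
      hermitianHullCount hq hF n k l < hermitianHullCount hq hF n k (l + 1)) := by
  obtain ⟨a, rfl⟩ : ∃ a, k = l + a + 1 := ⟨k - l - 1, by omega⟩
  obtain ⟨b, rfl⟩ : ∃ b, n = 2 * l + a + (b + 1 + 1) := ⟨n - 2 * l - a - 2, by omega⟩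
  have hrec := hermitianHullCount_succ_hull hq hF (l := l) (a := a) (b := b + 1) rfl
  have hpos := hermitianHullCount_pos hq hF (n := 2 * l + a + (b + 1 + 1)) l (a + 1) (b + 1)
    (by omega)
  rw [← add_assoc l a 1] at hpos
  have hdim : Even (2 * l + a + (b + 1 + 1)) ↔ Even (a + b) := by
    simp only [Nat.even_add, Nat.even_mul, even_two, true_or, true_iff, Nat.not_even_one]
    tauto
  generalize hermitianHullCount hq hF _ (l + a + 1) l = A at *
  generalize hermitianHullCount hq hF _ (l + a + 1) (l + 1) = A' at *
  rw [hdim]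
  have hX : (0 : ℤ) < q ^ (a + (b + 1)) * (q ^ (2 * l + 2) - 1) := by
    have hq1 : (1 : ℤ) < q := by exact_mod_cast hq.one_lt
    exact mul_pos (by positivity) (sub_pos.2 (one_lt_pow₀ hq1 (by omega)))
  constructor
  · intro h
    have hlt : ((q : ℤ) ^ (a + 1) - (-1) ^ (a + 1)) * (q ^ (b + 1) - (-1) ^ (b + 1)) <
        q ^ (a + (b + 1)) * (q ^ (2 * l + 2) - 1) := by
      by_cases hgen : 3 ≤ q ∨ 1 ≤ l
      · exact factor_lt_of_generic hq.one_lt hgen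
      · obtain rfl : q = 2 := by have := hq.one_lt; omega
        obtain rfl : l = 0 := by omega
        have := two_pow_factor_lt (a := a) (b := b) fun h' => h ⟨rfl, rfl, by omega, h'.2⟩
        simpa using this
    zify
    refine lt_of_mul_lt_mul_right (a := (q : ℤ) ^ (a + (b + 1)) * (q ^ (2 * l + 2) - 1)) ?_ hX.le
    rw [hrec]
    exact mul_lt_mul_of_pos_left hlt (by exact_mod_cast hpos)
  · rintro ⟨rfl, rfl, hk, hab⟩
    have := lt_two_pow_factor (a := a) (b := b) (by omega) hab
    zify
    refine lt_of_mul_lt_mul_right (a := ((2 : ℕ) : ℤ) ^ (a + (b + 1)) * ((2 : ℕ) ^ (2 * 0 + 2) - 1))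
      ?_ hX.le
    rw [hrec]
    exact mul_lt_mul_of_pos_left (by simpa using this) (by exact_mod_cast hpos)
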